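/- **Language.** Gradual terms are $t,T ::= x \mid \mathsf{Type}_i\ (i\ge 1) \mid (x:T_1)\to T_2 \mid \lambda x.t \mid t_1\,t_2 \mid t::T \mid\ ?$, up to renaming of bound variables; static terms are those without $?$. Gradual canonical forms are $u,U ::= \lambda x.u \mid (x:U_1)\xrightarrow{a}U_2 \mid \mathsf{Type}_i \mid x\,e \mid\ ?$, where the spine $e$ is a finite list of canonical forms and $a\in\{1,2,\dots\}\cup\{\omega\}$; forgetting annotations, they are gradual terms. Static canonical forms have neither $?$ nor annotations. The concretization $\gamma$ maps $?$ to the set of all static expressions (of the relevant kind) and acts componentwise on every other form (forgetting annotations). On canonical forms, $U\cong U'$ means $\gamma(U)\cap\gamma(U')\ne\emptyset$ and $U\sqsubseteq U'$ means $\gamma(U)\subseteq\gamma(U')$. **Ideal classes.** For a static term $s$ let $[s]$ be its class for $\alpha\beta\eta$-equivalence (the congruence generated by $\beta$, $\eta$ and $s::S = s$). A gradual term $t$ represents the set $\hat\gamma(t)=\{[t'] : t'\in\gamma(t)\}$ of static classes. A gradual class is a set of static classes that is an intersection of sets $\hat\gamma(s)$; $\alpha(A)$ is the least gradual class containing $A$,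 and $\sqsubseteq$ on gradual classes is inclusion. The ideal class of $t$ is $t^{\alpha\beta\eta}=\alpha(\hat\gamma(t))=\hat\gamma(t)$. Ideal substitution of gradual classes is $[x\Mapsto C_1]C_2=\alpha(\{[[x\Mapsto t_1']t_2'] : [t_1']\in C_1,[t_2']\in C_2\})$, and it contracts redexes: $((\lambda x.t_2)\,t_1)^{\alpha\beta\eta}=[x\Mapsto t_1^{\alpha\beta\eta}]t_2^{\alpha\beta\eta}$. **Approximate substitution** $[u/x]^U v$ of $u$ for $x$ at type $U$ is defined on canonical forms. It acts componentwise except on atomic forms with head $x$, where it returns a form together with a type. The head $x$ returns $u:U$. For $x\,e\,v$, let $x\,e$ return $w:W$, and $v'=[u/x]^Uv$. If $W=\,?$, or $W$ is not an arrow type, the result is $?:\,?$. If $W=(y:V_1)\to V_2$ and $V_1\not\prec U$, it is $?:\,?$. If $V_1\prec U$, its type is $[v'/y]^{V_1}V_2$ and its form is $[v'/y]^{V_1}b$ when $w=\lambda y.b$, the atomic form $w\,v'$ when $w$ is atomic, and $?$ when $w$ is $?$, a universe or an arrow type. Here $V\prec U$ compares the multisets of annotations of all arrows occurring in $V$ and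 $U$ by the Dershowitz–Manna multiset order, with $i<\omega$ for all $i$. Domain and codomain: $\mathrm{dom}$ of $(y:U_1)\to U_2$ is $U_1$ and its codomain at $u$ is $[u/y]^{U_1}U_2$; for $?$ both are $?$; they are undefined otherwise. **Approximate normalization**, written $\Gamma\vdash t\rightsquigarrow u\Rightarrow U$ (synthesis) and $\Gamma\vdash u\leftsquigarrow t\Leftarrow U$ (checking), where $\Gamma$ assigns canonical types to variables, is generated by: - *Synthesis.* A variable $x$ gives its $\eta$-expansion at its type $\Gamma(x)$, and synthesizes $\Gamma(x)$. $\mathsf{Type}_i$ gives itself and $\mathsf{Type}_{i+1}$. $?$ gives $?$ and $?$. $t::T$ gives the $u$ with $\Gamma\vdash u\leftsquigarrow t\Leftarrow U$, and $U$, where $U$ is the normal form of $T$ with level synthesis. For $t_1\,t_2$, if $\Gamma\vdash t_1\rightsquigarrow u_1\Rightarrow U$ and $\Gamma\vdash u_2\leftsquigarrow t_2\Leftarrow\mathrm{dom}\,U$, it gives $[u_2/y]^{\mathrm{dom}\,U}b$ if $u_1=\lambda y.b$ (an atomic $u_1$ is first $\eta$-expanded once to $\lambda y.u_1\,y$), and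 $?$ if $u_1$ is $?$, a universe or an arrow type; it synthesizes the codomain of $U$ at $u_2$. - *Checking.* If $t\rightsquigarrow u\Rightarrow U'$: against $U$ the result is $u$ if $U'\sqsubseteq U$, and $?$ if $U'\cong U$ but $U'\not\sqsubseteq U$; if $U'=\mathsf{Type}_i$ and $i<j$, the result against $\mathsf{Type}_j$ is $u$. $\lambda x.t$ against $(x:U_1)\to U_2$ gives $\lambda x.u$, with $t$ checked against $U_2$ under $x:U_1$; against $?$, with $t$ checked against $?$ under $x:\,?$. For $U=\mathsf{Type}_i$ (respectively $U=\,?$), $(x:T_1)\to T_2$ against $U$ gives $(x:U_1)\xrightarrow{i}U_2$ (respectively $(x:U_1)\xrightarrow{\omega}U_2$), with $T_1$ normalizing to $U_1$ against $U$, and $T_2$ to $U_2$ against $U$ under $x:U_1$. - *Level synthesis.* If $T$ synthesizes $\mathsf{Type}_i$, it has its normal form and level $i$; if $T$ synthesizes $?$, its normal form is $?$ at level $1$; for $(x:T_1)\to T_2$ with normal forms $U_1,U_2$ (the latter under $x:U_1$) at levels $i,j$, it is $(x:U_1)\xrightarrow{\max(i,j)}U_2$ at level $\max(i,j)$. **Typing**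 $\Gamma\vdash t\Rightarrow U$, $\Gamma\vdash t\Leftarrow U$ is generated by: $x\Rightarrow\Gamma(x)$; $\mathsf{Type}_i\Rightarrow\mathsf{Type}_{i+1}$; $?\Rightarrow\,?$; $(t::T)\Rightarrow U$ if $T$ has normal form $U$ with level synthesis and $t\Leftarrow U$; $t_1\,t_2\Rightarrow U_2$ if $t_1\Rightarrow U$, $t_2\Leftarrow\mathrm{dom}\,U$ with normal form $u_2$ at that type, and $U_2$ is the codomain of $U$ at $u_2$; $t\Leftarrow U$ if $t\Rightarrow U'\cong U$; $t\Leftarrow\mathsf{Type}_j$ if $t\Rightarrow\mathsf{Type}_i$ and $i<j$; $(x:T_1)\to T_2\Leftarrow U$ if $U\cong\mathsf{Type}_i$ for some $i$, $T_1\Leftarrow U$ with normal form $U_1$, and $T_2\Leftarrow U$ under $x:U_1$; $\lambda x.t\Leftarrow(x:U_1)\to U_2$ if $t\Leftarrow U_2$ under $x:U_1$; $\lambda x.t\Leftarrow\,?$ if $t\Leftarrow\,?$ under $x:\,?$. **Theorem (Normalization approximates the ideal).** For all $\Gamma,t,U$, if $\Gamma\vdash t\Leftarrow U$, then there is a canonical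 form $u$ with $\Gamma\vdash u\leftsquigarrow t\Leftarrow U$ and $t^{\alpha\beta\eta}\sqsubseteq u$; that is, every static term in $\gamma(t)$ is $\alpha\beta\eta$-equivalent to a static term in $\gamma(u)$, where $u$ is read as a gradual term. -/

import Mathlib

/-!
A gradual dependently typed language (predicative universes, dependent functions, the unknown
term `?`), its typing and approximate normalization, and the ideal meaning of gradual terms as
sets of static terms modulo alpha-beta-eta.  Variables are de Bruijn indices, so that
alpha-equivalent expressions are equal.  Universe levels are positive naturals: the lowest
universe is `Type_1`.
-/

namespace GDTL

/-- Renamings and their extension under a binder. -/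
def upRen (ρ : ℕ → ℕ) : ℕ → ℕ
  | 0 => 0
  | n + 1 => ρ n + 1

/-! ### Source terms, static and gradual -/

/-- Static terms.  `ann t T` is the ascription `t :: T`; `pi A B` binds one variable in `B`. -/
inductive STerm : Type
  | var (n : ℕ)
  | sort (i : ℕ+)
  | pi (A B : STerm)
  | lam (t : STerm)
  | app (t₁ t₂ : STerm)
  | ann (t T : STerm)

/-- Gradual terms: static syntax extended with the unknown term `?` (`dyn`). -/
inductive GTerm : Type
  | var (n : ℕ)
  | sort (i : ℕ+)
  | pi (A B : GTerm)
  | lam (t : GTerm)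
  | app (t₁ t₂ : GTerm)
  | ann (t T : GTerm)
  | dyn

namespace STerm

def ren (ρ : ℕ → ℕ) : STerm → STerm
  | var n => var (ρ n)
  | sort i => sort i
  | pi A B => pi (A.ren ρ) (B.ren (upRen ρ))
  | lam t => lam (t.ren (upRen ρ))
  | app t₁ t₂ => app (t₁.ren ρ) (t₂.ren ρ)
  | ann t T => ann (t.ren ρ) (T.ren ρ)

/-- Weakening by one fresh variable. -/
def shift (t : STerm) : STerm := t.ren Nat.succ

def upSub (σ : ℕ → STerm) : ℕ → STerm
  | 0 => var 0
  | n + 1 => (σ n).shift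

def subst (σ : ℕ → STerm) : STerm → STerm
  | var n => σ n
  | sort i => sort i
  | pi A B => pi (A.subst σ) (B.subst (upSub σ))
  | lam t => lam (t.subst (upSub σ))
  | app t₁ t₂ => app (t₁.subst σ) (t₂.subst σ)
  | ann t T => ann (t.subst σ) (T.subst σ)

/-- `t.inst s` is the (capture-avoiding, syntactic) substitution of `s` for the variable `0`
in `t`; the other variables are lowered by one. -/
def inst (t s : STerm) : STerm :=
  t.subst fun n => match n with
    | 0 => s
    | n + 1 => var n

end STerm

/-- Alpha-beta-eta-equivalence of static terms.  Static ascriptions have no computational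
content, so they are dropped. -/
inductive Conv : STerm → STerm → Prop
  | refl (t) : Conv t t
  | symm {s t} : Conv s t → Conv t s
  | trans {r s t} : Conv r s → Conv s t → Conv r t
  | beta (t s) : Conv (.app (.lam t) s) (t.inst s)
  | eta (t) : Conv (.lam (.app t.shift (.var 0))) t
  | erase (t T) : Conv (.ann t T) t
  | pi {A A' B B'} : Conv A A' → Conv B B' → Conv (.pi A B) (.pi A' B')
  | lam {t t'} : Conv t t' → Conv (.lam t) (.lam t')
  | app {s s' t t'} : Conv s s' → Conv t t' → Conv (.app s t) (.app s' t')
  | ann {t t' T T'} : Conv t t' → Conv T T' → Conv (.ann t T) (.ann t' T')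

instance STerm.setoid : Setoid STerm := ⟨Conv, Conv.refl, Conv.symm, Conv.trans⟩

/-- Static alpha-beta-eta-equivalence classes. -/
abbrev SClass : Type := Quotient STerm.setoid

/-! ### Ideal equivalence classes and ideal substitution -/

/-- Concretization of gradual terms: `?` stands for every static term, and all other forms are
concretized componentwise. -/
def GTerm.conc : GTerm → Set STerm
  | .var n => {.var n}
  | .sort i => {.sort i}
  | .pi A B => {s | ∃ A' ∈ A.conc, ∃ B' ∈ B.conc, s = .pi A' B'}
  | .lam t => {s | ∃ t' ∈ t.conc, s = .lam t'}
  | .app t₁ t₂ => {s | ∃ t₁' ∈ t₁.conc, ∃ t₂' ∈ t₂.conc, s = .app t₁' t₂'}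
  | .ann t T => {s | ∃ t' ∈ t.conc, ∃ T' ∈ T.conc, s = .ann t' T'}
  | .dyn => Set.univ

/-- The static equivalence classes that a gradual term represents. -/
def GTerm.classes (t : GTerm) : Set SClass := (fun s => (⟦s⟧ : SClass)) '' t.conc

/-- A gradual equivalence class, given by its concretization `conc`, the set of static
equivalence classes that it represents.  Such a set must be determined by the gradual terms whose
concretization contains it. -/
structure GClass : Type where
  conc : Set SClass
  closed : ∀ c, (∀ s : GTerm, conc ⊆ s.classes → c ∈ s.classes) → c ∈ conc

/-- Precision of gradual equivalence classes: inclusion of the concretizations. -/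
def GClass.MorePrecise (a b : GClass) : Prop := a.conc ⊆ b.conc

/-- Abstraction: the most precise gradual equivalence class representing all classes of `A`. -/
def abstraction (A : Set SClass) : GClass where
  conc := {c | ∀ s : GTerm, A ⊆ s.classes → c ∈ s.classes}
  closed := fun _ hc s hs => hc s fun _ hd => hd s hs

/-- Abstraction is left adjoint to concretization. -/
theorem abstraction_morePrecise_iff (A : Set SClass) (b : GClass) :
    (abstraction A).MorePrecise b ↔ A ⊆ b.conc := by
  constructor
  · intro h c hc
    exact h fun s hs => hs hc
  · intro h c hc
    exact b.closed c fun s hs => hc s (h.trans hs)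

/-- The ideal alpha-beta-eta-equivalence class of a gradual term. -/
def GTerm.ideal (t : GTerm) : GClass := abstraction t.classes

/-- The concretization of the ideal class of `t` is the set of classes of concretizations
of `t`. -/
theorem GTerm.ideal_conc (t : GTerm) : t.ideal.conc = t.classes := by
  apply Set.Subset.antisymm
  · intro c hc
    exact hc t Set.Subset.rfl
  · intro c hc s hs
    exact hs hc

/-- Ideal substitution of the class `a` for the variable `0` in the class `b`: concretize both,
substitute in representatives, and abstract the classes of the results. -/
def idealSubst (a b : GClass) : GClass :=
  abstraction {c | ∃ s t : STerm, ⟦s⟧ ∈ a.conc ∧ ⟦t⟧ ∈ b.conc ∧ c = ⟦t.inst s⟧}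

/-- Ideal classes contract beta-redexes by ideal substitution. -/
theorem GTerm.ideal_beta (t s : GTerm) :
    (GTerm.app (.lam t) s).ideal = idealSubst s.ideal t.ideal := by
  unfold idealSubst
  rw [s.ideal_conc, t.ideal_conc]
  show abstraction _ = abstraction _
  congr 1
  ext c
  constructor
  · rintro ⟨_, ⟨_, ⟨t', ht, rfl⟩, s', hs, rfl⟩, rfl⟩
    exact ⟨s', t', ⟨s', hs, rfl⟩, ⟨t', ht, rfl⟩, Quotient.sound (Conv.beta t' s')⟩
  · rintro ⟨s₁, t₁, ⟨s', hs, hs'⟩, ⟨t', ht, ht'⟩, rfl⟩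
    refine ⟨_, ⟨_, ⟨t', ht, rfl⟩, s', hs, rfl⟩, ?_⟩
    have h₁ : Conv s' s₁ := Quotient.exact hs'
    have h₂ : Conv t' t₁ := Quotient.exact ht'
    exact Quotient.sound ((Conv.app (Conv.lam h₂) h₁).trans (Conv.beta t₁ s₁))

/-! ### Canonical forms -/

mutual
/-- Static canonical forms; `ne` embeds the atomic forms `x e`. -/
inductive SCan : Type
  | lam (u : SCan)
  | pi (U₁ U₂ : SCan)
  | sort (i : ℕ+)
  | ne (r : SNe)
/-- A variable applied to a spine of canonical forms. -/
inductive SNe : Type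
  | var (n : ℕ)
  | app (r : SNe) (u : SCan)
end

/-- Annotations of gradual arrow types: a universe level, or the top level omega (`⊤`). -/
abbrev ArrowLevel : Type := WithTop ℕ+

mutual
/-- Gradual canonical forms; arrow types carry a level annotation. -/
inductive GCan : Type
  | lam (u : GCan)
  | pi (a : ArrowLevel) (U₁ U₂ : GCan)
  | sort (i : ℕ+)
  | ne (r : GNe)
  | dyn
/-- A variable applied to a spine of gradual canonical forms. -/
inductive GNe : Type
  | var (n : ℕ)
  | app (r : GNe) (u : GCan)
end

mutual
def GCan.ren (ρ : ℕ → ℕ) : GCan → GCan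
  | .lam u => .lam (GCan.ren (upRen ρ) u)
  | .pi a U₁ U₂ => .pi a (GCan.ren ρ U₁) (GCan.ren (upRen ρ) U₂)
  | .sort i => .sort i
  | .ne r => .ne (GNe.ren ρ r)
  | .dyn => .dyn
def GNe.ren (ρ : ℕ → ℕ) : GNe → GNe
  | .var n => .var (ρ n)
  | .app r u => .app (GNe.ren ρ r) (GCan.ren ρ u)
end

/-- Weakening by one fresh variable. -/
def GCan.shift (u : GCan) : GCan := u.ren Nat.succ

def GNe.shift (r : GNe) : GNe := r.ren Nat.succ

mutual
/-- Canonical forms as gradual terms (arrow annotations are not part of the source syntax). -/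
def GCan.toTerm : GCan → GTerm
  | .lam u => .lam (GCan.toTerm u)
  | .pi _ U₁ U₂ => .pi (GCan.toTerm U₁) (GCan.toTerm U₂)
  | .sort i => .sort i
  | .ne r => GNe.toTerm r
  | .dyn => .dyn
def GNe.toTerm : GNe → GTerm
  | .var n => .var n
  | .app r u => .app (GNe.toTerm r) (GCan.toTerm u)
end

mutual
/-- Concretization of gradual canonical forms as sets of static canonical forms. -/
def GCan.conc : GCan → Set SCan
  | .lam u => {s | ∃ u' ∈ GCan.conc u, s = .lam u'}
  | .pi _ U₁ U₂ => {s | ∃ U₁' ∈ GCan.conc U₁, ∃ U₂' ∈ GCan.conc U₂, s = .pi U₁' U₂'}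
  | .sort i => {.sort i}
  | .ne r => {s | ∃ r' ∈ GNe.conc r, s = .ne r'}
  | .dyn => Set.univ
def GNe.conc : GNe → Set SNe
  | .var n => {.var n}
  | .app r u => {s | ∃ r' ∈ GNe.conc r, ∃ u' ∈ GCan.conc u, s = .app r' u'}
end

/-- Consistency: the concretizations have a common element. -/
def GCan.Consistent (U U' : GCan) : Prop := (U.conc ∩ U'.conc).Nonempty

/-- Precision of canonical forms: inclusion of the concretizations. -/
def GCan.MorePrecise (U U' : GCan) : Prop := U.conc ⊆ U'.conc

mutual
/-- The multiset of annotations on the arrow types occurring in a canonical form. -/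
def GCan.arrows : GCan → Multiset ArrowLevel
  | .lam u => GCan.arrows u
  | .pi a U₁ U₂ => a ::ₘ (GCan.arrows U₁ + GCan.arrows U₂)
  | .sort _ => 0
  | .ne r => GNe.arrows r
  | .dyn => 0
def GNe.arrows : GNe → Multiset ArrowLevel
  | .var _ => 0
  | .app r u => GNe.arrows r + GCan.arrows u
end

/-- The order on types used for termination: the multiset ordering of arrow annotations. -/
def GCan.Below (U U' : GCan) : Prop := Multiset.IsDershowitzMannaLT U.arrows U'.arrows

/-- Eta-expansion of an atomic form at a type.  It depends only on the nesting of arrows in the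
type, so the types need not be weakened or instantiated along the way. -/
def GCan.etaExpand (r : GNe) : GCan → GCan
  | .pi _ A B =>
      .lam (GCan.etaExpand (.app r.shift (GCan.etaExpand (.var 0) A)) B)
  | .lam _ => .ne r
  | .sort _ => .ne r
  | .ne _ => .ne r
  | .dyn => .ne r

/-! ### Approximate hereditary substitution -/

/-- Universes and function types: canonical forms that fail when applied. -/
def GCan.NotApplicable : GCan → Prop
  | .sort _ => True
  | .pi _ _ _ => True
  | _ => False

/-- Types that are neither `?` nor an arrow type. -/
def GCan.NotFunType : GCan → Prop
  | .pi _ _ _ => False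
  | .dyn => False
  | _ => True

mutual
/-- `HSub k u U v w`: approximate hereditary substitution of `u`, at type `U`, for the variable
`k` in `v` gives `w`; the variables above `k` are lowered by one. -/
inductive HSub : ℕ → GCan → GCan → GCan → GCan → Prop
  | dyn {k u U} : HSub k u U .dyn .dyn
  | sort {k u U i} : HSub k u U (.sort i) (.sort i)
  | lam {k u U v w} : HSub (k + 1) u.shift U.shift v w → HSub k u U (.lam v) (.lam w)
  | pi {k u U a V₁ V₂ W₁ W₂} : HSub k u U V₁ W₁ → HSub (k + 1) u.shift U.shift V₂ W₂ →
      HSub k u U (.pi a V₁ V₂) (.pi a W₁ W₂)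
  | diff {k u U r r'} : HSubDiff k u U r r' → HSub k u U (.ne r) (.ne r')
  | spine {k u U r w W} : HSubSpine k u U r w W → HSub k u U (.ne r) w
/-- Substitution for `k` in an atomic form whose head is another variable. -/
inductive HSubDiff : ℕ → GCan → GCan → GNe → GNe → Prop
  | lt {k u U n} : n < k → HSubDiff k u U (.var n) (.var n)
  | gt {k u U n} : k < n → HSubDiff k u U (.var n) (.var (n - 1))
  | app {k u U r r' v w} : HSubDiff k u U r r' → HSub k u U v w →
      HSubDiff k u U (.app r v) (.app r' w)
/-- `HSubSpine k u U r w W`: substitution for `k` in an atomic form `r` with head `k` gives the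
canonical form `w` together with its type `W`. -/
inductive HSubSpine : ℕ → GCan → GCan → GNe → GCan → GCan → Prop
  | head {k u U} : HSubSpine k u U (.var k) u U
  /- Applying a function of type `?` gives `?`. -/
  | dynType {k u U r v w v'} : HSubSpine k u U r w .dyn → HSub k u U v v' →
      HSubSpine k u U (.app r v) .dyn .dyn
  /- The type does not decrease: approximate by `?`. -/
  | order {k u U r v w v' a V₁ V₂} : HSubSpine k u U r w (.pi a V₁ V₂) → HSub k u U v v' →
      ¬ V₁.Below U → HSubSpine k u U (.app r v) .dyn .dyn
  /- The head has become a function: continue with its body. -/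
  | lamSpine {k u U r v b v' a V₁ V₂ w W} :
      HSubSpine k u U r (.lam b) (.pi a V₁ V₂) → HSub k u U v v' → V₁.Below U →
      HSub 0 v' V₁ b w → HSub 0 v' V₁ V₂ W → HSubSpine k u U (.app r v) w W
  /- Applying the term `?` gives `?`. -/
  | dynSpine {k u U r v v' a V₁ V₂ W} :
      HSubSpine k u U r .dyn (.pi a V₁ V₂) → HSub k u U v v' → V₁.Below U →
      HSub 0 v' V₁ V₂ W → HSubSpine k u U (.app r v) .dyn W
  /- The head is an atomic form, treated as its eta-expansion. -/
  | neSpine {k u U r v r' v' a V₁ V₂ W} :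
      HSubSpine k u U r (.ne r') (.pi a V₁ V₂) → HSub k u U v v' → V₁.Below U →
      HSub 0 v' V₁ V₂ W → HSubSpine k u U (.app r v) (.ne (.app r' v')) W
  /- The application would fail, since the head is not a function: approximate by `?`. -/
  | failTerm {k u U r v w v' a V₁ V₂ W} :
      HSubSpine k u U r w (.pi a V₁ V₂) → w.NotApplicable → HSub k u U v v' → V₁.Below U →
      HSub 0 v' V₁ V₂ W → HSubSpine k u U (.app r v) .dyn W
  /- The application would fail, since the head has no function type: approximate by `?`. -/
  | failType {k u U r v w v' V} : HSubSpine k u U r w V → V.NotFunType → HSub k u U v v' →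
      HSubSpine k u U (.app r v) .dyn .dyn
end

/-- Domain of a type, a partial function. -/
inductive Dom : GCan → GCan → Prop
  | pi {a U₁ U₂} : Dom (.pi a U₁ U₂) U₁
  | dyn : Dom .dyn .dyn

/-- `CodSub u U V`: substituting `u` in the codomain of the type `U` gives `V`. -/
inductive CodSub : GCan → GCan → GCan → Prop
  | pi {u a U₁ U₂ V} : HSub 0 u U₁ U₂ V → CodSub u (.pi a U₁ U₂) V
  | dyn {u} : CodSub u .dyn .dyn

/-- One-level eta-expansion at type `? → ?`: atomic forms become functions, and other canonical
forms do not change. -/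
def GCan.etaDyn : GCan → GCan
  | .ne r => .lam (.ne (.app r.shift (.ne (.var 0))))
  | .lam u => .lam u
  | .pi a U₁ U₂ => .pi a U₁ U₂
  | .sort i => .sort i
  | .dyn => .dyn

/-- `BodySub u U f w`: substituting `u`, at type `U`, in the body of the function `f` gives `w`.
The unknown term gives `?`, and so do the forms that fail when applied. -/
inductive BodySub : GCan → GCan → GCan → GCan → Prop
  | lam {u U b w} : HSub 0 u U b w → BodySub u U (.lam b) w
  | dyn {u U} : BodySub u U .dyn .dyn
  | fail {u U f} : f.NotApplicable → BodySub u U f .dyn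

/-! ### Approximate normalization and typing -/

/-- Contexts; the head of the list is the type of variable `0`, and each type lives in the
context given by the tail that follows it. -/
abbrev Ctx : Type := List GCan

/-- `Lookup Γ n U`: variable `n` has type `U` in `Γ`, with `U` weakened to all of `Γ`. -/
inductive Lookup : Ctx → ℕ → GCan → Prop
  | zero {Γ U} : Lookup (U :: Γ) 0 U.shift
  | succ {Γ U V n} : Lookup Γ n U → Lookup (V :: Γ) (n + 1) U.shift

mutual
/-- `NormSynth Γ t u U`: in `Γ`, the term `t` normalizes to `u` and synthesizes the type `U`. -/
inductive NormSynth : Ctx → GTerm → GCan → GCan → Prop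
  | ann {Γ t T u U i} : NormType Γ U T i → NormCheck Γ u t U →
      NormSynth Γ (.ann t T) u U
  | sort {Γ i} : NormSynth Γ (.sort i) (.sort i) (.sort (i + 1))
  | var {Γ n U} : Lookup Γ n U → NormSynth Γ (.var n) (GCan.etaExpand (.var n) U) U
  | dyn {Γ} : NormSynth Γ .dyn .dyn .dyn
  | app {Γ t₁ t₂ u₁ u₂ u₃ U U₁ U₂} : NormSynth Γ t₁ u₁ U → Dom U U₁ →
      NormCheck Γ u₂ t₂ U₁ → CodSub u₂ U U₂ → BodySub u₂ U₁ u₁.etaDyn u₃ →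
      NormSynth Γ (.app t₁ t₂) u₃ U₂
/-- `NormCheck Γ u t U`: in `Γ`, the term `t` normalizes to `u` when checked against `U`. -/
inductive NormCheck : Ctx → GCan → GTerm → GCan → Prop
  | synth {Γ t u U U'} : NormSynth Γ t u U' → U'.MorePrecise U → NormCheck Γ u t U
  | approx {Γ t u U U'} : NormSynth Γ t u U' → U'.Consistent U → ¬ U'.MorePrecise U →
      NormCheck Γ .dyn t U
  | level {Γ t u i j} : NormSynth Γ t u (.sort i) → i < j → NormCheck Γ u t (.sort j)
  | piType {Γ T₁ T₂ U₁ U₂ i} : NormCheck Γ U₁ T₁ (.sort i) →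
      NormCheck (U₁ :: Γ) U₂ T₂ (.sort i) →
      NormCheck Γ (.pi (i : ArrowLevel) U₁ U₂) (.pi T₁ T₂) (.sort i)
  | piDyn {Γ T₁ T₂ U₁ U₂} : NormCheck Γ U₁ T₁ .dyn → NormCheck (U₁ :: Γ) U₂ T₂ .dyn →
      NormCheck Γ (.pi ⊤ U₁ U₂) (.pi T₁ T₂) .dyn
  | lamPi {Γ t u a U₁ U₂} : NormCheck (U₁ :: Γ) u t U₂ →
      NormCheck Γ (.lam u) (.lam t) (.pi a U₁ U₂)
  | lamDyn {Γ t u} : NormCheck (.dyn :: Γ) u t .dyn → NormCheck Γ (.lam u) (.lam t) .dyn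
/-- `NormType Γ U T i`: level synthesis.  In `Γ`, the type `T` normalizes to `U`, and `i` is the
synthesized universe level at which it resides. -/
inductive NormType : Ctx → GCan → GTerm → ℕ+ → Prop
  | synth {Γ T U i} : NormSynth Γ T U (.sort i) → NormType Γ U T i
  | dyn {Γ T U} : NormSynth Γ T U .dyn → NormType Γ .dyn T 1
  | pi {Γ T₁ T₂ U₁ U₂ i j} : NormType Γ U₁ T₁ i → NormType (U₁ :: Γ) U₂ T₂ j →
      NormType Γ (.pi ((max i j : ℕ+) : ArrowLevel) U₁ U₂) (.pi T₁ T₂) (max i j)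
end

mutual
/-- `Synth Γ t U`: the gradual term `t` synthesizes the type `U`. -/
inductive Synth : Ctx → GTerm → GCan → Prop
  | ann {Γ t T U i} : NormType Γ U T i → Check Γ t U → Synth Γ (.ann t T) U
  | sort {Γ i} : Synth Γ (.sort i) (.sort (i + 1))
  | var {Γ n U} : Lookup Γ n U → Synth Γ (.var n) U
  | dyn {Γ} : Synth Γ .dyn .dyn
  | app {Γ t₁ t₂ u₂ U U₁ U₂} : Synth Γ t₁ U → Dom U U₁ → Check Γ t₂ U₁ →
      NormCheck Γ u₂ t₂ U₁ → CodSub u₂ U U₂ → Synth Γ (.app t₁ t₂) U₂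
/-- `Check Γ t U`: the gradual term `t` checks against the type `U`. -/
inductive Check : Ctx → GTerm → GCan → Prop
  | synth {Γ t U U'} : Synth Γ t U' → U'.Consistent U → Check Γ t U
  | level {Γ t i j} : Synth Γ t (.sort i) → i < j → Check Γ t (.sort j)
  /- Against `U`, which is consistent with some `Type_i`, hence equal to some `Type_i` or to `?`,
  so that it needs no weakening. -/
  | pi {Γ T₁ T₂ U₁ U i} : U.Consistent (.sort i) → Check Γ T₁ U → NormCheck Γ U₁ T₁ U →
      Check (U₁ :: Γ) T₂ U → Check Γ (.pi T₁ T₂) U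
  | lamPi {Γ t a U₁ U₂} : Check (U₁ :: Γ) t U₂ → Check Γ (.lam t) (.pi a U₁ U₂)
  | lamDyn {Γ t} : Check (.dyn :: Γ) t .dyn → Check Γ (.lam t) .dyn
end

end GDTL

namespace GDTL

/-! ### Renaming of canonical forms -/

-- The theorem splits into two independent halves: a well-typed term has some approximate normal
-- form, and every approximate normal form of a term covers all its static concretizations up to
-- conversion.
--
-- Existence rests on totality of hereditary substitution (`HSub.exists`): an outer well-founded
-- induction on the multiset of arrow annotations of the type, and inside it a structural induction
-- on the target. Substitution restarts on a possibly larger body only at a domain that is `Below`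
-- the current type; every other obstruction returns `?`.
--
-- Soundness (`HSub.covers`, `NormCheck.covers`) is an induction on derivations in which types play
-- no role. Each rule returns `?`, which covers everything, or acts componentwise, or is matched on
-- static representatives by a beta, eta or erasure step.

mutual
theorem GCan.arrows_ren : ∀ (u : GCan) (ρ : ℕ → ℕ), (u.ren ρ).arrows = u.arrows
  | .lam u, ρ => by simp only [GCan.ren, GCan.arrows, GCan.arrows_ren u]
  | .pi _ A B, ρ => by
      simp only [GCan.ren, GCan.arrows, GCan.arrows_ren A, GCan.arrows_ren B]
  | .sort _, ρ => rfl
  | .ne r, ρ => by simp only [GCan.ren, GCan.arrows, GNe.arrows_ren r]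
  | .dyn, ρ => rfl
theorem GNe.arrows_ren : ∀ (r : GNe) (ρ : ℕ → ℕ), (r.ren ρ).arrows = r.arrows
  | .var _, ρ => rfl
  | .app r u, ρ => by
      simp only [GNe.ren, GNe.arrows, GNe.arrows_ren r, GCan.arrows_ren u]
end

theorem GCan.arrows_shift (u : GCan) : u.shift.arrows = u.arrows :=
  u.arrows_ren Nat.succ

mutual
theorem GCan.ren_mem_conc : ∀ (u : GCan) (ρ : ℕ → ℕ) {s : STerm},
    s ∈ u.toTerm.conc → s.ren ρ ∈ (u.ren ρ).toTerm.conc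
  | .lam u, ρ, _, ⟨t, ht, e⟩ => e ▸ ⟨_, GCan.ren_mem_conc u (upRen ρ) ht, rfl⟩
  | .pi _ A B, ρ, _, ⟨a, ha, b, hb, e⟩ =>
      e ▸ ⟨_, GCan.ren_mem_conc A ρ ha, _, GCan.ren_mem_conc B (upRen ρ) hb, rfl⟩
  | .sort _, _, _, e => by cases e; rfl
  | .ne r, ρ, _, h => GNe.ren_mem_conc r ρ h
  | .dyn, _, _, _ => trivial
theorem GNe.ren_mem_conc : ∀ (r : GNe) (ρ : ℕ → ℕ) {s : STerm},
    s ∈ r.toTerm.conc → s.ren ρ ∈ (r.ren ρ).toTerm.conc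
  | .var _, _, _, e => by cases e; rfl
  | .app r u, ρ, _, ⟨a, ha, b, hb, e⟩ =>
      e ▸ ⟨_, GNe.ren_mem_conc r ρ ha, _, GCan.ren_mem_conc u ρ hb, rfl⟩
end

/-! ### Approximate hereditary substitution is total -/

mutual
-- Only the multiset `m` is fixed, not `U`: passing under a binder replaces `U` by `U.shift`, which
-- has the same annotations. `IH` is needed only where a spine meets an argument.
theorem HSub.exists_of_below {m : Multiset ArrowLevel}
    (IH : ∀ V : GCan, Multiset.IsDershowitzMannaLT V.arrows m → ∀ k u v, ∃ w, HSub k u V v w) :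
    ∀ (v : GCan) (k : ℕ) (u U : GCan), U.arrows = m → ∃ w, HSub k u U v w
  | .lam v, k, u, U, hU =>
      let ⟨_, h⟩ := HSub.exists_of_below IH v (k + 1) u.shift U.shift (U.arrows_shift.trans hU)
      ⟨_, .lam h⟩
  | .pi _ A B, k, u, U, hU =>
      let ⟨_, hA⟩ := HSub.exists_of_below IH A k u U hU
      let ⟨_, hB⟩ := HSub.exists_of_below IH B (k + 1) u.shift U.shift (U.arrows_shift.trans hU)
      ⟨_, .pi hA hB⟩
  | .sort _, _, _, _, _ => ⟨_, .sort⟩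
  | .ne r, k, u, U, hU =>
      match HSub.exists_ne_of_below IH r k u U hU with
      | .inl ⟨_, h⟩ => ⟨_, .diff h⟩
      | .inr ⟨_, _, h⟩ => ⟨_, .spine h⟩
  | .dyn, _, _, _, _ => ⟨_, .dyn⟩
-- The alternative is whether the head of `r` is `k`. In the second case no typing relation between
-- `w` and `W` is needed, since the spine rules exhaust all pairs of shapes.
theorem HSub.exists_ne_of_below {m : Multiset ArrowLevel}
    (IH : ∀ V : GCan, Multiset.IsDershowitzMannaLT V.arrows m → ∀ k u v, ∃ w, HSub k u V v w) :
    ∀ (r : GNe) (k : ℕ) (u U : GCan), U.arrows = m →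
      (∃ r', HSubDiff k u U r r') ∨ ∃ w W, HSubSpine k u U r w W
  | .var n, k, u, U, _ => by
      rcases lt_trichotomy n k with h | rfl | h
      · exact .inl ⟨_, .lt h⟩
      · exact .inr ⟨_, _, .head⟩
      · exact .inl ⟨_, .gt h⟩
  | .app r v, k, u, U, hU => by
      obtain ⟨v', hv⟩ := HSub.exists_of_below IH v k u U hU
      rcases HSub.exists_ne_of_below IH r k u U hU with ⟨r', hr⟩ | ⟨w, W, hr⟩
      · exact .inl ⟨_, .app hr hv⟩
      · right
        cases W with
        | lam _ => exact ⟨_, _, .failType hr trivial hv⟩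
        | sort _ => exact ⟨_, _, .failType hr trivial hv⟩
        | ne _ => exact ⟨_, _, .failType hr trivial hv⟩
        | dyn => exact ⟨_, _, .dynType hr hv⟩
        | pi a V₁ V₂ =>
          by_cases hb : V₁.Below U
          · have IH' := IH V₁ (hU ▸ hb) 0 v'
            obtain ⟨W, hW⟩ := IH' V₂
            cases w with
            | lam b =>
              obtain ⟨w, hw⟩ := IH' b
              exact ⟨_, _, .lamSpine hr hv hb hw hW⟩
            | pi _ _ _ => exact ⟨_, _, .failTerm hr trivial hv hb hW⟩
            | sort _ => exact ⟨_, _, .failTerm hr trivial hv hb hW⟩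
            | ne _ => exact ⟨_, _, .neSpine hr hv hb hW⟩
            | dyn => exact ⟨_, _, .dynSpine hr hv hb hW⟩
          · exact ⟨_, _, .order hr hv hb⟩
end

theorem HSub.exists (k : ℕ) (u U v : GCan) : ∃ w, HSub k u U v w := by
  -- The multiset order inherits well-foundedness from the levels, where omega sits above the
  -- positive integers.
  have wf : WellFounded (Multiset.IsDershowitzMannaLT : Multiset ArrowLevel → _ → Prop) :=
    Multiset.wellFounded_isDershowitzMannaLT
  have key : ∀ m : Multiset ArrowLevel, ∀ U : GCan, U.arrows = m →
      ∀ k u v, ∃ w, HSub k u U v w := by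
    intro m
    induction m using wf.induction with
    | _ m ih =>
      exact fun U hU k u v =>
        HSub.exists_of_below (fun V hV => ih V.arrows hV V rfl) v k u U hU
  exact key _ U rfl k u v

/-- `BodySub` has no rule for atomic forms; `etaDyn` turns exactly these into functions. -/
theorem BodySub.exists_etaDyn (u U f : GCan) : ∃ w, BodySub u U f.etaDyn w := by
  cases f with
  | lam b => exact (HSub.exists 0 u U b).imp fun _ => .lam
  | ne r => exact (HSub.exists 0 u U _).imp fun _ => .lam
  | pi _ _ _ => exact ⟨_, .fail trivial⟩
  | sort _ => exact ⟨_, .fail trivial⟩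
  | dyn => exact ⟨_, .dyn⟩

/-! ### Well-typed terms have approximate normal forms -/

/-- This matches the single typing rule for arrow types with the two normalization rules, at a
universe and at `?`. -/
theorem GCan.eq_of_consistent_sort {U : GCan} {i : ℕ+} (h : U.Consistent (.sort i)) :
    U = .sort i ∨ U = .dyn := by
  obtain ⟨s, hs, rfl⟩ := h
  cases U with
  | lam _ => obtain ⟨_, _, h⟩ := hs; cases h
  | pi _ _ _ => obtain ⟨_, _, _, _, h⟩ := hs; cases h
  | ne _ => obtain ⟨_, _, h⟩ := hs; cases h
  | sort _ => cases hs; exact .inl rfl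
  | dyn => exact .inr rfl

mutual
theorem Synth.exists_norm : ∀ {Γ : Ctx} {t : GTerm} {U : GCan},
    Synth Γ t U → ∃ u, NormSynth Γ t u U
  | _, _, _, .ann hT ht =>
      let ⟨_, hu⟩ := Check.exists_norm ht
      ⟨_, .ann hT hu⟩
  | _, _, _, .sort => ⟨_, .sort⟩
  | _, _, _, .var h => ⟨_, .var h⟩
  | _, _, _, .dyn => ⟨_, .dyn⟩
  -- The typing rule already carries the argument's normal form and the codomain at it. Reusing both
  -- avoids any appeal to determinism; only the body substitution has to be constructed.
  | _, _, _, .app h₁ hd _ h₂ hc =>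
      let ⟨u₁, hu₁⟩ := Synth.exists_norm h₁
      let ⟨_, hb⟩ := BodySub.exists_etaDyn _ _ u₁
      ⟨_, .app hu₁ hd h₂ hc hb⟩
theorem Check.exists_norm : ∀ {Γ : Ctx} {t : GTerm} {U : GCan},
    Check Γ t U → ∃ u, NormCheck Γ u t U
  | _, _, _, .synth (U := U) (U' := U') h hc => by
      obtain ⟨u, hu⟩ := Synth.exists_norm h
      by_cases hp : U'.MorePrecise U
      · exact ⟨_, .synth hu hp⟩
      · exact ⟨_, .approx hu hc hp⟩
  | _, _, _, .level h hl =>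
      let ⟨_, hu⟩ := Synth.exists_norm h
      ⟨_, .level hu hl⟩
  | _, _, _, .pi hc _ hA hB => by
      obtain ⟨B, hB⟩ := Check.exists_norm hB
      rcases GCan.eq_of_consistent_sort hc with rfl | rfl
      · exact ⟨_, .piType hA hB⟩
      · exact ⟨_, .piDyn hA hB⟩
  | _, _, _, .lamPi h =>
      let ⟨_, hu⟩ := Check.exists_norm h
      ⟨_, .lamPi hu⟩
  | _, _, _, .lamDyn h =>
      let ⟨_, hu⟩ := Check.exists_norm h
      ⟨_, .lamDyn hu⟩
end

/-! ### Soundness of approximate substitution -/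

/-- The static term `s` is convertible to one that `u` represents. -/
def GCan.Covers (u : GCan) (s : STerm) : Prop := ∃ s' ∈ u.toTerm.conc, Conv s s'

theorem GCan.covers_dyn (s : STerm) : GCan.dyn.Covers s := ⟨s, trivial, .refl s⟩

theorem GCan.Covers.of_conv {u : GCan} {s t : STerm} (h : u.Covers t) (c : Conv s t) :
    u.Covers s :=
  let ⟨t', ht, c'⟩ := h
  ⟨t', ht, c.trans c'⟩

theorem GCan.Covers.lam {u : GCan} {s : STerm} (h : u.Covers s) : (GCan.lam u).Covers (.lam s) :=
  let ⟨_, hs, c⟩ := h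
  ⟨_, ⟨_, hs, rfl⟩, .lam c⟩

theorem GCan.Covers.pi {A B : GCan} {s t : STerm} (hA : A.Covers s) (hB : B.Covers t)
    (a : ArrowLevel) : (GCan.pi a A B).Covers (.pi s t) :=
  let ⟨_, hs, c⟩ := hA
  let ⟨_, ht, c'⟩ := hB
  ⟨_, ⟨_, hs, _, ht, rfl⟩, .pi c c'⟩

theorem GCan.Covers.app {r : GNe} {u : GCan} {s t : STerm} (hr : (GCan.ne r).Covers s)
    (hu : u.Covers t) : (GCan.ne (.app r u)).Covers (.app s t) :=
  let ⟨_, hs, c⟩ := hr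
  let ⟨_, ht, c'⟩ := hu
  ⟨_, ⟨_, hs, _, ht, rfl⟩, .app c c'⟩

/-- The substitution of `s` for the variable `k` that lowers the variables above `k`. -/
def STerm.single (k : ℕ) (s : STerm) (n : ℕ) : STerm :=
  if n < k then .var n else if n = k then s else .var (n - 1)

theorem STerm.upSub_single (k : ℕ) (s : STerm) :
    STerm.upSub (STerm.single k s) = STerm.single (k + 1) s.shift := by
  funext n
  cases n with
  | zero => simp [upSub, single]
  | succ n =>
    rcases lt_trichotomy n k with h | rfl | h
    · simp [upSub, single, h, shift, ren]
    · simp [upSub, single]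
    -- Truncated subtraction is harmless here because `k < n` makes `n` positive.
    · have : n - 1 + 1 = n := by omega
      simp [upSub, single, h.not_gt, h.ne', shift, ren, this]

theorem STerm.inst_eq_subst_single (t s : STerm) : t.inst s = t.subst (STerm.single 0 s) := by
  unfold STerm.inst
  congr 1
  funext n
  cases n <;> rfl

mutual
-- The hypotheses ask for actual members of the concretizations and the conclusion only for
-- conversion, so each use of an induction hypothesis first picks representatives and then
-- transports along the conversions.
theorem HSub.covers : ∀ {k : ℕ} {u U v w : GCan}, HSub k u U v w →
    ∀ {s t : STerm}, s ∈ u.toTerm.conc → t ∈ v.toTerm.conc →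
      w.Covers (t.subst (STerm.single k s))
  | _, _, _, _, _, .dyn, _, _, _, _ => GCan.covers_dyn _
  | _, _, _, _, _, .sort, _, _, _, ht => by
      cases ht
      exact ⟨_, rfl, .refl _⟩
  | _, _, _, _, _, .lam h, _, _, hs, ht => by
      obtain ⟨t, ht, rfl⟩ := ht
      have := HSub.covers h (GCan.ren_mem_conc _ Nat.succ hs) ht
      rw [← STerm.shift, ← STerm.upSub_single] at this
      exact this.lam
  | _, _, _, _, _, .pi hA hB, _, _, hs, ht => by
      obtain ⟨a, ha, b, hb, rfl⟩ := ht
      have := HSub.covers hB (GCan.ren_mem_conc _ Nat.succ hs) hb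
      rw [← STerm.shift, ← STerm.upSub_single] at this
      exact (HSub.covers hA hs ha).pi this _
  | _, _, _, _, _, .diff h, _, _, hs, ht => HSubDiff.covers h hs ht
  | _, _, _, _, _, .spine h, _, _, hs, ht => HSubSpine.covers h hs ht
theorem HSubDiff.covers : ∀ {k : ℕ} {u U : GCan} {r r' : GNe}, HSubDiff k u U r r' →
    ∀ {s t : STerm}, s ∈ u.toTerm.conc → t ∈ r.toTerm.conc →
      (GCan.ne r').Covers (t.subst (STerm.single k s))
  | _, _, _, _, _, .lt h, _, _, _, ht => by
      cases ht
      refine ⟨_, rfl, ?_⟩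
      simp only [STerm.subst, STerm.single, h, if_true]
      exact .refl _
  | _, _, _, _, _, .gt h, _, _, _, ht => by
      cases ht
      refine ⟨_, rfl, ?_⟩
      simp only [STerm.subst, STerm.single, h.not_gt, h.ne', if_false]
      exact .refl _
  | _, _, _, _, _, .app hr hv, _, _, hs, ht => by
      obtain ⟨a, ha, b, hb, rfl⟩ := ht
      exact (HSubDiff.covers hr hs ha).app (HSub.covers hv hs hb)
theorem HSubSpine.covers : ∀ {k : ℕ} {u U : GCan} {r : GNe} {w W : GCan},
    HSubSpine k u U r w W →
    ∀ {s t : STerm}, s ∈ u.toTerm.conc → t ∈ r.toTerm.conc →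
      w.Covers (t.subst (STerm.single k s))
  | _, _, _, _, _, _, .head, _, _, hs, ht => by
      cases ht
      refine ⟨_, hs, ?_⟩
      simp only [STerm.subst, STerm.single, lt_irrefl, if_true, if_false]
      exact .refl _
  | _, _, _, _, _, _, .dynType _ _, _, _, _, _ => GCan.covers_dyn _
  | _, _, _, _, _, _, .order _ _ _, _, _, _, _ => GCan.covers_dyn _
  | _, _, _, _, _, _, .lamSpine hr hv _ hb _, _, _, hs, ht => by
      obtain ⟨a, ha, b, hb', rfl⟩ := ht
      -- The function part converts to some `lam f` and the argument to some `x`. The inner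
      -- substitution covers the contractum of `f` at `x`, one beta step away from the application.
      obtain ⟨_, ⟨f, hf, rfl⟩, cf⟩ := HSubSpine.covers hr hs ha
      obtain ⟨x, hx, cx⟩ := HSub.covers hv hs hb'
      refine (HSub.covers hb hx hf).of_conv ?_
      rw [← STerm.inst_eq_subst_single]
      exact (Conv.app cf cx).trans (.beta _ _)
  | _, _, _, _, _, _, .dynSpine _ _ _ _, _, _, _, _ => GCan.covers_dyn _
  | _, _, _, _, _, _, .neSpine hr hv _ _, _, _, hs, ht => by
      obtain ⟨a, ha, b, hb, rfl⟩ := ht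
      exact (HSubSpine.covers hr hs ha).app (HSub.covers hv hs hb)
  | _, _, _, _, _, _, .failTerm _ _ _ _ _, _, _, _, _ => GCan.covers_dyn _
  | _, _, _, _, _, _, .failType _ _ _, _, _, _, _ => GCan.covers_dyn _
end

/-! ### Soundness of approximate normalization -/

/-- The atomic form must stay general: the domain is used at variable `0` and the codomain at a
longer spine. -/
theorem GCan.covers_etaExpand (U : GCan) {r : GNe} {s : STerm} (hs : s ∈ r.toTerm.conc) :
    (GCan.etaExpand r U).Covers s := by
  match U with
  | .pi _ A B =>
    obtain ⟨x, hx, cx⟩ := GCan.covers_etaExpand A (r := .var 0) rfl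
    have hr : STerm.app s.shift x ∈ (GNe.app r.shift (GCan.etaExpand (.var 0) A)).toTerm.conc :=
      ⟨_, GNe.ren_mem_conc r Nat.succ hs, _, hx, rfl⟩
    refine (GCan.covers_etaExpand B hr).lam.of_conv ?_
    -- The bound variable is itself expanded at `A`, so after the eta step it is replaced by the
    -- convertible `x`.
    exact (Conv.eta s).symm.trans (.lam (.app (.refl _) cx))
  | .lam _ | .sort _ | .ne _ | .dyn => exact ⟨s, hs, .refl s⟩
termination_by structural U

theorem GCan.Covers.etaDyn {u : GCan} {s : STerm} (h : u.Covers s) : u.etaDyn.Covers s := by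
  cases u with
  | ne r =>
    obtain ⟨s', hs, c⟩ := h
    refine ⟨.lam (.app s'.shift (.var 0)), ?_, c.trans (Conv.eta s').symm⟩
    exact ⟨_, ⟨_, GNe.ren_mem_conc r Nat.succ hs, _, rfl, rfl⟩, rfl⟩
  | _ => exact h

theorem BodySub.covers {u U f w : GCan} (h : BodySub u U f w) {s t : STerm}
    (ht : f.Covers t) (hs : u.Covers s) : w.Covers (.app t s) := by
  cases h with
  | dyn => exact GCan.covers_dyn _
  | fail => exact GCan.covers_dyn _
  | lam hb =>
    obtain ⟨_, ⟨b, hb', rfl⟩, ct⟩ := ht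
    obtain ⟨s', hs, cs⟩ := hs
    refine (hb.covers hs hb').of_conv ?_
    rw [← STerm.inst_eq_subst_single]
    exact (Conv.app ct cs).trans (.beta _ _)

mutual
theorem NormSynth.covers : ∀ {Γ : Ctx} {t : GTerm} {u U : GCan}, NormSynth Γ t u U →
    ∀ {s : STerm}, s ∈ t.conc → u.Covers s
  | _, _, _, _, .ann _ ht, _, hs => by
      -- Conversion discards the ascribed type, so nothing about its normal form has to be known.
      obtain ⟨t', ht', _, _, rfl⟩ := hs
      exact (NormCheck.covers ht ht').of_conv (.erase _ _)
  | _, _, _, _, .sort, _, hs => ⟨_, hs, .refl _⟩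
  | _, _, _, _, .var _, _, hs => GCan.covers_etaExpand _ hs
  | _, _, _, _, .dyn, _, _ => GCan.covers_dyn _
  | _, _, _, _, .app h₁ _ h₂ _ hb, _, hs => by
      obtain ⟨_, hs₁, _, hs₂, rfl⟩ := hs
      exact hb.covers (NormSynth.covers h₁ hs₁).etaDyn (NormCheck.covers h₂ hs₂)
theorem NormCheck.covers : ∀ {Γ : Ctx} {t : GTerm} {u U : GCan}, NormCheck Γ u t U →
    ∀ {s : STerm}, s ∈ t.conc → u.Covers s
  | _, _, _, _, .synth h _, _, hs => NormSynth.covers h hs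
  | _, _, _, _, .approx _ _ _, _, _ => GCan.covers_dyn _
  | _, _, _, _, .level h _, _, hs => NormSynth.covers h hs
  | _, _, _, _, .piType hA hB, _, hs => by
      obtain ⟨_, hs₁, _, hs₂, rfl⟩ := hs
      exact (NormCheck.covers hA hs₁).pi (NormCheck.covers hB hs₂) _
  | _, _, _, _, .piDyn hA hB, _, hs => by
      obtain ⟨_, hs₁, _, hs₂, rfl⟩ := hs
      exact (NormCheck.covers hA hs₁).pi (NormCheck.covers hB hs₂) _
  | _, _, _, _, .lamPi h, _, hs => by
      obtain ⟨_, hs, rfl⟩ := hs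
      exact (NormCheck.covers h hs).lam
  | _, _, _, _, .lamDyn h, _, hs => by
      obtain ⟨_, hs, rfl⟩ := hs
      exact (NormCheck.covers h hs).lam
end

theorem NormCheck.ideal_morePrecise {Γ : Ctx} {t : GTerm} {u U : GCan} (h : NormCheck Γ u t U) :
    t.ideal.MorePrecise u.toTerm.ideal := by
  unfold GClass.MorePrecise
  rw [GTerm.ideal_conc, GTerm.ideal_conc]
  rintro _ ⟨s, hs, rfl⟩
  obtain ⟨s', hs', c⟩ := h.covers hs
  exact ⟨s', hs', Quotient.sound c.symm⟩

end GDTL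

theorem mainTheorem6 (Γ : GDTL.Ctx) (t : GDTL.GTerm) (U : GDTL.GCan) (h : GDTL.Check Γ t U) :
    ∃ u : GDTL.GCan, GDTL.NormCheck Γ u t U ∧ t.ideal.MorePrecise u.toTerm.ideal := by
  obtain ⟨u, hu⟩ := h.exists_norm
  exact ⟨u, hu, hu.ideal_morePrecise⟩
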